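/- \textbf{Definitions.} Let $X$ be a set. For $T:X\times X\to X\times X$ write $T(x,y)=(T^1(x,y),T^2(x,y))$. Call $T$ left invertible if for all $x,z$ there is a unique $y$ with $T^1(x,y)=z$, and right invertible if for all $y,t$ there is a unique $x$ with $T^2(x,y)=t$. A \emph{biquandle} $(X,S)$ is a bijective, left and right invertible map $S:X\times X\to X\times X$ with $(1\times S)(S\times 1)(1\times S)=(S\times 1)(1\times S)(S\times 1)$ for which there is a bijection $s:X\to X$ with $\{(x,y):S(x,y)=(x,y)\}=\{(x,s(x)):x\in X\}$. A \emph{singular pair} $(X,S,\tau)$ is a biquandle $(X,S)$ with a bijective, left and right invertible map $\tau:X\times X\to X\times X$ such that $\tau S=S\tau$, $(S\times 1)(1\times S)(\tau\times 1)=(1\times\tau)(S\times 1)(1\times S)$ and $(1\times S)(S\times 1)(1\times\tau)=(\tau\times 1)(1\times S)(S\times 1)$. Let $H$ be an abelian group, written multiplicatively. Maps $f,h:X\times X\to H$ form an \emph{abelian 2-cocycle pair} for $(X,S,\tau)$ if for all $x,y,z\in X$ \begin{itemize} \item $f(x,y)\,f(S^2(x,y),z)\,f(S^1(x,y),S^1(S^2(x,y),z))=f(x,S^1(y,z))\,f(S^2(x,S^1(y,z)),S^2(y,z))\,f(y,z)$;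 \item $f(x,s(x))=1$; \item $h(y,z)\,f(x,\tau^1(y,z))\,f(S^2(x,\tau^1(y,z)),\tau^2(y,z))=f(x,y)\,f(S^2(x,y),z)\,h(S^1(x,y),S^1(S^2(x,y),z))$; \item $f(y,z)\,f(x,S^1(y,z))\,h(S^2(x,S^1(y,z)),S^2(y,z))=h(x,y)\,f(\tau^2(x,y),z)\,f(\tau^1(x,y),S^1(\tau^2(x,y),z))$; \item $f(x,y)\,h(S(x,y))=h(x,y)\,f(\tau(x,y))$. \end{itemize} Let $L$ be an oriented planar singular link diagram; each of its crossings is positive, negative or singular. Draw each crossing with both strands running downwards, and label its upper left, upper right, lower left, lower right semi-arcs by $a,b,c,d$. A \emph{coloring} of $L$ assigns an element of $X$ to each semi-arc so that $(c,d)=S(a,b)$ at every positive crossing, $(a,b)=S(c,d)$ at every negative crossing, and $(c,d)=\tau(a,b)$ at every singular crossing. The \emph{weight} of the crossing is $f(a,b)$, $f(c,d)^{-1}$, $h(a,b)$, respectively. Let $\mathrm{Col}_X(L)$ be the set of colorings and, if it is finite, \[ \Phi_{f,h}(L)=\sum_{\mathcal C\in \mathrm{Col}_X(L)}\ \prod_{\gamma}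 B_{f,h}(\gamma,\mathcal C)\ \in\ \mathbb Z[H], \] where $B_{f,h}(\gamma,\mathcal C)$ is the weight of the crossing $\gamma$ and the product is over all crossings of $L$. \textbf{Theorem.} Let $(X,S,\tau)$ be a singular pair and $(f,h)$ an abelian 2-cocycle pair with values in an abelian group $H$. Let $L$ and $L'$ be oriented planar singular link diagrams that represent the same singular link, that is, are related by a finite sequence of planar isotopies and of oriented classical (RI, RII, RIII) and singular (RIV, i.e. a strand moves over or under a singular crossing; RV, i.e. a classical crossing of two strands moves across a singular crossing of the same strands) Reidemeister moves, in all orientations. If $\mathrm{Col}_X(L)$ is finite (for example, if $X$ is finite), then $\mathrm{Col}_X(L')$ is finite and $\Phi_{f,h}(L)=\Phi_{f,h}(L')$. -/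

import Mathlib

open scoped BigOperators

namespace SingularLinks

/-! ### Biquandles, singular pairs and abelian cocycle pairs -/

section Algebra

variable {X : Type*}

/-- `S × 1` on `X × X × X`. -/
def onFst (S : X × X → X × X) (p : X × X × X) : X × X × X :=
  ((S (p.1, p.2.1)).1, (S (p.1, p.2.1)).2, p.2.2)

/-- `1 × S` on `X × X × X`. -/
def onSnd (S : X × X → X × X) (p : X × X × X) : X × X × X :=
  (p.1, S p.2)

/-- For any `x, z` there is a unique `y` with `S¹(x, y) = z`. -/
def LeftInvertible (S : X × X → X × X) : Prop :=
  ∀ x z, ∃! y, (S (x, y)).1 = z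

/-- For any `y, t` there is a unique `x` with `S²(x, y) = t`. -/
def RightInvertible (S : X × X → X × X) : Prop :=
  ∀ y t, ∃! x, (S (x, y)).2 = t

/-- A birack: a bijective, left and right invertible solution of the set theoretical
Yang-Baxter equation. -/
structure IsBirack (S : X × X → X × X) : Prop where
  bijective : Function.Bijective S
  yangBaxter : onSnd S ∘ onFst S ∘ onSnd S = onFst S ∘ onSnd S ∘ onFst S
  left_inv : LeftInvertible S
  right_inv : RightInvertible S

/-- A biquandle: a birack whose fixed point set is the graph of a bijection `s : X → X`. -/
structure IsBiquandle (S : X × X → X × X) : Prop extends IsBirack S where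
  fixedPoints : ∃ s : Equiv.Perm X, ∀ x y, S (x, y) = (x, y) ↔ y = s x

/-- `(X, S, τ)` is a singular pair. -/
structure IsSingularPair (S τ : X × X → X × X) : Prop where
  biquandle : IsBiquandle S
  bijective : Function.Bijective τ
  left_inv : LeftInvertible τ
  right_inv : RightInvertible τ
  comm : τ ∘ S = S ∘ τ
  slide_left : onFst S ∘ onSnd S ∘ onFst τ = onSnd τ ∘ onFst S ∘ onSnd S
  slide_right : onSnd S ∘ onFst S ∘ onSnd τ = onFst τ ∘ onSnd S ∘ onFst S

/-- `(f, h)` is an abelian 2-cocycle pair for `(X, S, τ)`. In `fixed`, the hypothesis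
`S (x, y) = (x, y)` says `y = s x`. -/
structure IsAbelianCocyclePair {H : Type*} [CommGroup H] (S τ : X × X → X × X)
    (f h : X × X → H) : Prop where
  cocycle : ∀ x y z,
    f (x, y) * f ((S (x, y)).2, z) * f ((S (x, y)).1, (S ((S (x, y)).2, z)).1) =
      f (x, (S (y, z)).1) * f ((S (x, (S (y, z)).1)).2, (S (y, z)).2) * f (y, z)
  fixed : ∀ x y, S (x, y) = (x, y) → f (x, y) = 1
  compat_right : ∀ x y z,
    h (y, z) * f (x, (τ (y, z)).1) * f ((S (x, (τ (y, z)).1)).2, (τ (y, z)).2) =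
      f (x, y) * f ((S (x, y)).2, z) * h ((S (x, y)).1, (S ((S (x, y)).2, z)).1)
  compat_left : ∀ x y z,
    f (y, z) * f (x, (S (y, z)).1) * h ((S (x, (S (y, z)).1)).2, (S (y, z)).2) =
      h (x, y) * f ((τ (x, y)).2, z) * f ((τ (x, y)).1, (S ((τ (x, y)).2, z)).1)
  compat_comm : ∀ x y, f (x, y) * h (S (x, y)) = h (x, y) * f (τ (x, y))

end Algebra

/-! ### Oriented singular tangles and link diagrams

A crossing is always drawn with its two strands running downwards, so that it has an upper left
and an upper right incoming semi-arc, and a lower left and a lower right outgoing semi-arc. The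
strand that comes in on the left goes out on the right, and conversely. -/

/-- The two sides, in the picture, of a crossing drawn with both strands running downwards. -/
inductive Side
  | left
  | right
  deriving DecidableEq

instance : Fintype Side := ⟨{.left, .right}, by rintro (_ | _) <;> simp⟩

/-- The opposite side. -/
def Side.other : Side → Side
  | left => right
  | right => left

/-- The kind of a crossing: classical positive (`classical true`: the strand that comes in on the
right is the over strand), classical negative (`classical false`: the strand that comes in on the
left is the over strand), or singular. -/
inductive Kind
  | classical (positive : Bool)
  | singular

/-- Combinatorial data of an oriented singular tangle diagram. It has one entry and one exit on the
boundary for each element of `σ`. `V` is the set of crossings and `E` the set of semi-arcs.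
`tail` gives the semi-arc that begins at an entry, or at the lower side `s` of a crossing;
`head` gives the semi-arc that ends at an exit, or at the upper side `s` of a crossing.
A semi-arc has at most one beginning and at most one end, and has a beginning if and only if it has
an end; the semi-arcs without either are the closed components without crossings. -/
structure Tangle (σ : Type) where
  V : Type
  E : Type
  [fintypeV : Fintype V]
  [finiteE : Finite E]
  kind : V → Kind
  tail : σ ⊕ (V × Side) → E
  head : σ ⊕ (V × Side) → E
  tail_injective : Function.Injective tail
  head_injective : Function.Injective head
  range_tail : Set.range tail = Set.range head

attribute [instance] Tangle.fintypeV Tangle.finiteE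

/-- The incoming semi-arc at the upper side `s` of the crossing `v`. -/
def Tangle.inn {σ : Type} (T : Tangle σ) (v : T.V) (s : Side) : T.E := T.head (Sum.inr (v, s))

/-- The outgoing semi-arc at the lower side `s` of the crossing `v`. -/
def Tangle.out {σ : Type} (T : Tangle σ) (v : T.V) (s : Side) : T.E := T.tail (Sum.inr (v, s))

/-- A closed diagram: a tangle diagram without boundary. -/
abbrev Diagram : Type 1 := Tangle Empty

/-! ### Planarity -/

/-- Every semi-arc `e` has two sides `(e, left)` and `(e, right)` (in the picture where `e` runs
downwards). Two of these are adjacent if they are the two sides of one of the four corners at a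
crossing (upper, lower, left, right corner). -/
inductive Diagram.CornerAdj (D : Diagram) : D.E × Side → D.E × Side → Prop
  | upper (v : D.V) : CornerAdj D (D.inn v .left, .right) (D.inn v .right, .left)
  | lower (v : D.V) : CornerAdj D (D.out v .left, .right) (D.out v .right, .left)
  | left (v : D.V) : CornerAdj D (D.inn v .left, .left) (D.out v .left, .left)
  | right (v : D.V) : CornerAdj D (D.inn v .right, .right) (D.out v .right, .right)

/-- The faces of the closed surfaces in which the connected pieces of `D` are cellularly embedded
(a closed component without crossings lies on a sphere and has two faces). -/
def Diagram.Face (D : Diagram) : Type := Quot D.CornerAdj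

/-- Two semi-arcs are adjacent if they meet at some crossing. -/
def Diagram.MeetAt (D : Diagram) (e e' : D.E) : Prop :=
  ∃ v : D.V, (∃ s, e = D.inn v s ∨ e = D.out v s) ∧ (∃ s, e' = D.inn v s ∨ e' = D.out v s)

/-- The connected pieces of the underlying 4-valent graph of `D`. -/
def Diagram.Piece (D : Diagram) : Type := Quot D.MeetAt

/-- `D` can be drawn in the plane (equivalently, on the sphere): every connected piece has genus
zero. As a piece with `n ≥ 1` crossings has `2 n` semi-arcs, its Euler characteristic is
`n - 2 n + F`; the closed components without crossings have `n = 0` and `F = 2`. -/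
def Diagram.IsPlanar (D : Diagram) : Prop :=
  Nat.card D.Face = Nat.card D.V + 2 * Nat.card D.Piece

/-- An oriented singular link diagram in the plane. -/
def PlanarDiagram : Type 1 := {D : Diagram // D.IsPlanar}

/-! ### Tangles from Gauss codes -/

/-- The tangle diagram in which every strand `i : σ` runs from entry `i` to exit `i` and passes `m`
times through a crossing. The strand that comes into the crossing `v` on the side `s` is
`(pass (v, s)).1`, and it does so on its passage number `(pass (v, s)).2`. -/
def Tangle.ofPasses {σ V : Type} [Finite σ] [Fintype V] {m : ℕ} (kind : V → Kind)
    (pass : V × Side → σ × Fin m) (hpass : Function.Bijective pass) : Tangle σ where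
  V := V
  E := σ × Fin (m + 1)
  kind := kind
  head := Sum.elim (fun i => (i, Fin.last m)) fun q => ((pass q).1, (pass q).2.castSucc)
  tail := Sum.elim (fun i => (i, 0))
    fun q => ((pass (q.1, q.2.other)).1, (pass (q.1, q.2.other)).2.succ)
  head_injective := by
    rintro (i | q) (j | r) hq
    · simpa using hq
    · simp only [Sum.elim_inl, Sum.elim_inr, Prod.mk.injEq] at hq
      exact absurd hq.2.symm (Fin.castSucc_lt_last _).ne
    · simp only [Sum.elim_inl, Sum.elim_inr, Prod.mk.injEq] at hq
      exact absurd hq.2 (Fin.castSucc_lt_last _).ne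
    · simp only [Sum.elim_inr, Prod.mk.injEq] at hq
      exact congrArg Sum.inr
        (hpass.1 (Prod.ext hq.1 (Fin.castSucc_injective _ hq.2)))
  tail_injective := by
    rintro (i | q) (j | r) hq
    · simpa using hq
    · simp only [Sum.elim_inl, Sum.elim_inr, Prod.mk.injEq] at hq
      exact absurd hq.2.symm (Fin.succ_ne_zero _)
    · simp only [Sum.elim_inl, Sum.elim_inr, Prod.mk.injEq] at hq
      exact absurd hq.2 (Fin.succ_ne_zero _)
    · simp only [Sum.elim_inr, Prod.mk.injEq] at hq
      have h1 := hpass.1 (Prod.ext hq.1 (Fin.succ_injective _ hq.2))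
      obtain ⟨v, s⟩ := q
      obtain ⟨w, t⟩ := r
      simp only [Prod.mk.injEq] at h1
      obtain ⟨rfl, h2⟩ := h1
      cases s <;> cases t <;> simp_all [Side.other]
  range_tail := by
    have hh : Set.range (Sum.elim (fun i : σ => (i, Fin.last m))
        fun q : V × Side => ((pass q).1, (pass q).2.castSucc)) = Set.univ := by
      refine Set.eq_univ_of_forall ?_
      rintro ⟨i, k⟩
      induction k using Fin.lastCases with
      | last => exact ⟨Sum.inl i, rfl⟩
      | cast k =>
        obtain ⟨q, hq⟩ := hpass.2 (i, k)
        exact ⟨Sum.inr q, by simp [hq]⟩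
    have ht : Set.range (Sum.elim (fun i : σ => (i, (0 : Fin (m + 1)))) fun q : V × Side =>
        ((pass (q.1, q.2.other)).1, (pass (q.1, q.2.other)).2.succ)) = Set.univ := by
      refine Set.eq_univ_of_forall ?_
      rintro ⟨i, k⟩
      induction k using Fin.cases with
      | zero => exact ⟨Sum.inl i, rfl⟩
      | succ k =>
        obtain ⟨⟨v, s⟩, hq⟩ := hpass.2 (i, k)
        have hs : s.other.other = s := by cases s <;> rfl
        exact ⟨Sum.inr (v, s.other), by simp [hs, hq]⟩
    rw [hh, ht]

/-- Strands without crossings. -/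
def parallelStrands (σ : Type) [Finite σ] : Tangle σ :=
  Tangle.ofPasses (V := Empty) (m := 0) (fun v => v.elim) (fun q => q.1.elim)
    ⟨fun q => q.1.elim, fun q => q.2.elim0⟩

/-- The passages of a kink: the strand comes into the crossing first on side `s`, then on the other
side (so the loop of the kink is on the side opposite to `s`). -/
def kinkPass (s : Side) (q : Unit × Side) : Unit × Fin 2 :=
  ((), if q.2 = s then 0 else 1)

/-- A strand with one kink. -/
def kink (positive : Bool) (s : Side) : Tangle Unit :=
  Tangle.ofPasses (V := Unit) (fun _ => .classical positive) (kinkPass s) (by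
    cases s <;> decide)

/-- The possible shapes of a bigon between two oriented strands: the strands run through it
in parallel, or in opposite directions; in the last case the bigon lies on the right or on the left
of both of its crossings. -/
inductive BigonShape
  | parallel
  | oppositeRight
  | oppositeLeft

/-- The passages of two strands `false` and `true` that meet at two crossings `false` and `true`,
which span a bigon. -/
def bigonPass : BigonShape → Bool × Side → Bool × Fin 2
  | .parallel, (false, .left) => (false, 0)
  | .parallel, (false, .right) => (true, 0)
  | .parallel, (true, .left) => (true, 1)
  | .parallel, (true, .right) => (false, 1)
  | .oppositeRight, (false, .left) => (false, 0)
  | .oppositeRight, (false, .right) => (true, 1)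
  | .oppositeRight, (true, .left) => (true, 0)
  | .oppositeRight, (true, .right) => (false, 1)
  | .oppositeLeft, (false, .left) => (true, 1)
  | .oppositeLeft, (false, .right) => (false, 0)
  | .oppositeLeft, (true, .left) => (false, 1)
  | .oppositeLeft, (true, .right) => (true, 0)

/-- Two strands spanning a bigon, with crossings of kinds `k` and `k'`, in the order in which the
strand `false` meets them. -/
def bigon (b : BigonShape) (k k' : Kind) : Tangle Bool :=
  Tangle.ofPasses (V := Bool) (fun v => bif v then k' else k) (bigonPass b) (by
    cases b <;> decide)

/-- `0` if the statement `first` holds and `1` otherwise. -/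
def passNumber (first : Bool) : Fin 2 := if first then 0 else 1

/-- The passages of three directed lines `0, 1, 2` in general position; crossing `0` is that of the
lines `0, 1`, crossing `1` that of `0, 2`, and crossing `2` that of `1, 2`. The booleans `l01`,
`l02`, `l12` are true if the line with the smaller number comes into the respective crossing on the
left. Three directions in the plane realize any choice of these. For given directions the lines
form one of two triangles, that differ by the order of the two crossings on each of the three lines;
`e` chooses between them:
* line `0` meets line `1` before line `2` iff `l02 = e`;
* line `1` meets line `0` before line `2` iff `l12 = e`;
* line `2` meets line `0` before line `1` iff `(l01 xor l02 xor l12) = e`. -/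
def trianglePass (l01 l02 l12 e : Bool) (q : Fin 3 × Side) : Fin 3 × Fin 2 :=
  let e0 := l02 == e
  let e1 := l12 == e
  let e2 := (l01 ^^ l02 ^^ l12) == e
  match q.1 with
  | 0 => if l01 = decide (q.2 = .left) then (0, passNumber e0) else (1, passNumber e1)
  | 1 => if l02 = decide (q.2 = .left) then (0, passNumber !e0) else (2, passNumber e2)
  | 2 => if l12 = decide (q.2 = .left) then (1, passNumber !e1) else (2, passNumber !e2)

/-- The kinds of crossings of a triangle: the lines `0` and `1` have a crossing of kind `k`, and the
line `2` passes over (if `isOver`) or under (otherwise) both of them. -/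
def triangleKind (l02 l12 isOver : Bool) (k : Kind) : Fin 3 → Kind
  | 0 => k
  | 1 => .classical (l02 == isOver)
  | 2 => .classical (l12 == isOver)

/-- The triangle formed by two strands `0` and `1` with a crossing of kind `k` and a strand `2`
that passes over or under both. -/
def triangle (l01 l02 l12 isOver : Bool) (k : Kind) (e : Bool) : Tangle (Fin 3) :=
  Tangle.ofPasses (triangleKind l02 l12 isOver k) (trianglePass l01 l02 l12 e) (by
    revert l01 l02 l12 e; decide)

/-! ### Reidemeister moves -/

/-- The oriented classical and singular Reidemeister moves, in all orientations. -/
inductive LocalMove : {σ : Type} → Tangle σ → Tangle σ → Prop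
  /-- RI: a classical kink. -/
  | RI (positive : Bool) (s : Side) : LocalMove (parallelStrands Unit) (kink positive s)
  /-- RII: two classical crossings of opposite signs. -/
  | RII (b : BigonShape) (positive : Bool) :
      LocalMove (parallelStrands Bool) (bigon b (.classical positive) (.classical !positive))
  /-- RIII: a strand moves over or under a classical crossing. -/
  | RIII (l01 l02 l12 isOver positive : Bool) :
      LocalMove (triangle l01 l02 l12 isOver (.classical positive) true)
        (triangle l01 l02 l12 isOver (.classical positive) false)
  /-- RIV (RIVa and RIVb): a strand moves under or over a singular crossing. -/
  | RIV (l01 l02 l12 isOver : Bool) :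
      LocalMove (triangle l01 l02 l12 isOver .singular true)
        (triangle l01 l02 l12 isOver .singular false)
  /-- RV: a classical crossing moves across a singular crossing of the same two strands. -/
  | RV (b : BigonShape) (positive : Bool) :
      LocalMove (bigon b (.classical positive) .singular) (bigon b .singular (.classical positive))

/-- The identifications of semi-arcs when the exits of each of the tangles `O` and `T` are joined to
the entries of the other. -/
inductive GlueRel {σ : Type} (O T : Tangle σ) : O.E ⊕ T.E → O.E ⊕ T.E → Prop
  | enter (i : σ) : GlueRel O T (.inl (O.head (.inl i))) (.inr (T.tail (.inl i)))
  | exit (i : σ) : GlueRel O T (.inr (T.head (.inl i))) (.inl (O.tail (.inl i)))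

/-- `D` is obtained from the outer part `O` and the inner part `T` by joining the exits of each of
them to the entries of the other: the crossings of `D` are those of `O` and `T`, the semi-arcs of
`D` are those of `O` and `T` modulo the identifications along the boundary. -/
def IsGluing {σ : Type} (O T : Tangle σ) (D : Diagram) : Prop :=
  ∃ (v : O.V ⊕ T.V ≃ D.V) (e : O.E ⊕ T.E → D.E),
    Function.Surjective e ∧
    (∀ a b, e a = e b ↔ Relation.EqvGen (GlueRel O T) a b) ∧
    (∀ c, D.kind (v (.inl c)) = O.kind c) ∧
    (∀ c, D.kind (v (.inr c)) = T.kind c) ∧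
    (∀ c s, D.inn (v (.inl c)) s = e (.inl (O.inn c s))) ∧
    (∀ c s, D.inn (v (.inr c)) s = e (.inr (T.inn c s))) ∧
    (∀ c s, D.out (v (.inl c)) s = e (.inl (O.out c s))) ∧
    (∀ c s, D.out (v (.inr c)) s = e (.inr (T.out c s)))

/-- Isomorphic diagrams. -/
def Diagram.Iso (D D' : Diagram) : Prop :=
  ∃ (v : D.V ≃ D'.V) (e : D.E ≃ D'.E),
    (∀ c, D'.kind (v c) = D.kind c) ∧
    (∀ c s, D'.inn (v c) s = e (D.inn c s)) ∧
    (∀ c s, D'.out (v c) s = e (D.out c s))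

/-- `D` and `D'` are isomorphic, or are equal outside of an inner part to which one of the classical
or singular Reidemeister moves is applied. -/
inductive ReidemeisterStep (D D' : PlanarDiagram) : Prop
  | iso (i : Diagram.Iso D.1 D'.1)
  | move {σ : Type} (O T T' : Tangle σ) (m : LocalMove T T')
      (g : IsGluing O T D.1) (g' : IsGluing O T' D'.1)

/-- Two planar diagrams represent the same singular link: the equivalence relation generated by the
classical and the singular Reidemeister moves. -/
def SameLink : PlanarDiagram → PlanarDiagram → Prop := Relation.EqvGen ReidemeisterStep

/-! ### Colorings and the partition function -/

section StateSum

variable {X : Type*}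

/-- The coloring rule at a crossing with colors `i` on the (left, right) incoming semi-arcs and
`o` on the (left, right) outgoing ones. -/
def Kind.Rule (S τ : X × X → X × X) : Kind → X × X → X × X → Prop
  | .classical true, i, o => o = S i
  | .classical false, i, o => i = S o
  | .singular, i, o => o = τ i

/-- The Boltzmann weight of a crossing with colors `i` on the incoming and `o` on the outgoing
semi-arcs. -/
def Kind.weight {H : Type*} [CommGroup H] (f h : X × X → H) : Kind → X × X → X × X → H
  | .classical true, i, _ => f i
  | .classical false, _, o => (f o)⁻¹
  | .singular, i, _ => h i

/-- The colors of the incoming semi-arcs at `v`. -/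
def Tangle.inColors {σ : Type} (T : Tangle σ) (c : T.E → X) (v : T.V) : X × X :=
  (c (T.inn v .left), c (T.inn v .right))

/-- The colors of the outgoing semi-arcs at `v`. -/
def Tangle.outColors {σ : Type} (T : Tangle σ) (c : T.E → X) (v : T.V) : X × X :=
  (c (T.out v .left), c (T.out v .right))

/-- The set `Col_X(D)` of colorings of the semi-arcs of `D`. -/
def Tangle.Coloring {σ : Type} (S τ : X × X → X × X) (D : Tangle σ) : Type _ :=
  {c : D.E → X // ∀ v, (D.kind v).Rule S τ (D.inColors c v) (D.outColors c v)}

/-- The product of the Boltzmann weights of all crossings. -/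
def Tangle.weight {σ : Type} {H : Type*} [CommGroup H] (f h : X × X → H) (D : Tangle σ)
    (c : D.E → X) : H :=
  ∏ v, (D.kind v).weight f h (D.inColors c v) (D.outColors c v)

/-- The partition function: the sum in `ℤ[H]` over all colorings of the products of the weights,
for a diagram with finitely many colorings. -/
noncomputable def Tangle.stateSum {σ : Type} {H : Type*} [CommGroup H] (S τ : X × X → X × X)
    (f h : X × X → H) (D : Tangle σ) : MonoidAlgebra ℤ H :=
  ∑ᶠ c : D.Coloring S τ, MonoidAlgebra.of ℤ H (D.weight f h c.1)

end StateSum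

end SingularLinks

/-!
The theorem holds because a move replaces a tangle `T` inside a diagram by a tangle `T'` that looks
the same from outside. For a tangle, consider the triples of the colors at the entries, the colors
at the exits and the total weight that come from its colorings. If `T` and `T'` have the same
triples, and a coloring of either is determined by its colors on the boundary, then replacing the
inner part of a coloring is a bijection between the colorings of two diagrams that have the same
outer part, and it preserves weights (`sameColorings_of_localMove`).

A crossing is encoded by a relation `R a b c d g` between its four colors and its weight. All three
kinds of crossings are switches: the two colors at any one of the four corners determine everything
else. A strand of a kink, a bigon or a triangle has only one inner semi-arc, so each crossing there
has boundary semi-arcs at one of its corners, and the colors on the boundary determine the coloring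
(`isDetermined_ofPasses_two`).

A strand sliding across a crossing of type `R` is the single property `Slides S R`, in the
orientation where the strand runs from right to left below or above the crossing. The other
orientations follow from it by prescribing the colors at other corners; whether the strand is over
or under is the choice between `S` and its inverse, and `R` may be replaced by its inverse as well
(`simulates_triangle`).

The other point of substance is a classical crossing moving across a singular one when the strands
run in opposite directions (`CrossingRel.flipsRight`). Besides `τ ∘ S = S ∘ τ`, this uses all slides
and the fixed points of `S`. The trick is to add a strand whose first crossing is a kink, slide it
under the given crossings, and then slide another strand over the resulting singular crossing, which
produces another kink. By the fixed point condition both kinks preserve colors and have trivial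
weight, so that they can be discarded.
-/

namespace SingularLinks

/-! ### Crossing relations -/

section WeightedSwitch

variable {X H : Type*}

/-- A weighted crossing relation: `R a b c d g` says that a crossing may carry the colors `a, b` on
its upper left and upper right semi-arcs and `c, d` on its lower left and lower right ones, and that
its weight is then `g`. -/
abbrev CrossingRel (X H : Type*) : Type _ := X → X → X → X → H → Prop

/-- The crossing relation of a map `S` with the weights `f`. -/
def CrossingRel.ofMap (S : X × X → X × X) (f : X × X → H) : CrossingRel X H :=
  fun a b c d g => S (a, b) = (c, d) ∧ f (a, b) = g

/-- The colors at any of the four corners of a crossing can be prescribed, and determine the other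
two colors and the weight. -/
structure CrossingRel.IsSwitch (R : CrossingRel X H) : Prop where
  exists_upper : ∀ a b, ∃ c d g, R a b c d g
  exists_lower : ∀ c d, ∃ a b g, R a b c d g
  exists_left : ∀ a c, ∃ b d g, R a b c d g
  exists_right : ∀ b d, ∃ a c g, R a b c d g
  unique : ∀ {a b c d g a' b' c' d' g'}, R a b c d g → R a' b' c' d' g' →
    ((a = a' ∧ b = b') ∨ (c = c' ∧ d = d') ∨ (a = a' ∧ c = c') ∨ (b = b' ∧ d = d')) →
    a = a' ∧ b = b' ∧ c = c' ∧ d = d' ∧ g = g'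

theorem CrossingRel.isSwitch_ofMap {S : X × X → X × X} (hS : Function.Bijective S)
    (hl : LeftInvertible S) (hr : RightInvertible S) (f : X × X → H) :
    (CrossingRel.ofMap S f).IsSwitch where
  exists_upper a b := ⟨_, _, _, rfl, rfl⟩
  exists_lower c d := by
    obtain ⟨⟨a, b⟩, h⟩ := hS.2 (c, d)
    exact ⟨a, b, _, h, rfl⟩
  exists_left a c := by
    obtain ⟨b, h, -⟩ := hl a c
    exact ⟨b, _, _, Prod.ext h rfl, rfl⟩
  exists_right b d := by
    obtain ⟨a, h, -⟩ := hr b d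
    exact ⟨a, _, _, Prod.ext rfl h, rfl⟩
  unique := by
    rintro a b c d g a' b' c' d' g' ⟨h, rfl⟩ ⟨h', rfl⟩ hc
    have key : a = a' ∧ b = b' := by
      rcases hc with hc | ⟨rfl, rfl⟩ | ⟨rfl, rfl⟩ | ⟨rfl, rfl⟩
      · exact hc
      · simpa using hS.1 (h.trans h'.symm)
      · exact ⟨rfl, (hl a c).unique (congrArg Prod.fst h) (congrArg Prod.fst h')⟩
      · exact ⟨(hr b d).unique (congrArg Prod.snd h) (congrArg Prod.snd h'), rfl⟩
    obtain ⟨rfl, rfl⟩ := key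
    have := h.symm.trans h'
    simp_all

variable [CommGroup H]

/-- The crossing relation of the inverse map, with the inverse weights. -/
def CrossingRel.inv (R : CrossingRel X H) : CrossingRel X H := fun a b c d g => R c d a b g⁻¹

@[simp]
theorem CrossingRel.inv_inv (R : CrossingRel X H) : R.inv.inv = R := by
  funext a b c d g
  simp [CrossingRel.inv]

theorem CrossingRel.inv_of {R : CrossingRel X H} {a b c d : X} {g : H} (h : R a b c d g) :
    R.inv c d a b g⁻¹ := by
  simpa [CrossingRel.inv] using h

theorem CrossingRel.IsSwitch.inv {R : CrossingRel X H} (hR : R.IsSwitch) : R.inv.IsSwitch where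
  exists_upper a b := by
    obtain ⟨c, d, g, h⟩ := hR.exists_lower a b
    exact ⟨c, d, g⁻¹, by simpa [CrossingRel.inv] using h⟩
  exists_lower a b := by
    obtain ⟨c, d, g, h⟩ := hR.exists_upper a b
    exact ⟨c, d, g⁻¹, by simpa [CrossingRel.inv] using h⟩
  exists_left a b := by
    obtain ⟨c, d, g, h⟩ := hR.exists_left b a
    exact ⟨d, c, g⁻¹, by simpa [CrossingRel.inv] using h⟩
  exists_right a b := by
    obtain ⟨c, d, g, h⟩ := hR.exists_right b a
    exact ⟨d, c, g⁻¹, by simpa [CrossingRel.inv] using h⟩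
  unique h h' hc := by
    obtain ⟨h1, h2, h3, h4, h5⟩ := hR.unique h h' (by tauto)
    exact ⟨h3, h4, h1, h2, inv_injective h5⟩

/-- A strand `r` that crosses from right to left below a crossing of type `R`, by crossings of type
`S`, can be moved above it. -/
def CrossingRel.Slides (S R : CrossingRel X H) : Prop :=
  ∀ ⦃p q r p' q' r₁ q'' r₂ p'' s₁ q₁ s₂ p₁ g₁ g₂ g₃ g₄ g₅⦄,
    R p q p' q' g₁ → S q' r r₁ q'' g₂ → S p' r₁ r₂ p'' g₃ →
    S q r s₁ q₁ g₄ → S p s₁ s₂ p₁ g₅ →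
    s₂ = r₂ ∧ ∃ g₆, R p₁ q₁ p'' q'' g₆ ∧ g₁ * g₂ * g₃ = g₄ * g₅ * g₆

theorem CrossingRel.Slides.inv {S R : CrossingRel X H} (h : S.Slides R) : S.Slides R.inv := by
  intro p q r p' q' r₁ q'' r₂ p'' s₁ q₁ s₂ p₁ g₁ g₂ g₃ g₄ g₅ h1 h2 h3 h4 h5
  obtain ⟨rfl, g, h6, hg⟩ := h h1 h4 h5 h2 h3
  refine ⟨rfl, g⁻¹, by simpa [CrossingRel.inv] using h6, ?_⟩
  rw [eq_mul_inv_iff_mul_eq, mul_assoc, mul_assoc, ← mul_assoc g₂, ← hg]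
  simp [mul_assoc]

theorem CrossingRel.slides_ofMap {S ρ : X × X → X × X} {f w : X × X → H}
    (hs : onFst S ∘ onSnd S ∘ onFst ρ = onSnd ρ ∘ onFst S ∘ onSnd S)
    (hw : ∀ x y z, f (y, z) * f (x, (S (y, z)).1) * w ((S (x, (S (y, z)).1)).2, (S (y, z)).2) =
      w (x, y) * f ((ρ (x, y)).2, z) * f ((ρ (x, y)).1, (S ((ρ (x, y)).2, z)).1)) :
    (CrossingRel.ofMap S f).Slides (CrossingRel.ofMap ρ w) := by
  rintro p q r p' q' r₁ q'' r₂ p'' s₁ q₁ s₂ p₁ g₁ g₂ g₃ g₄ g₅ ⟨h1, rfl⟩ ⟨h2, rfl⟩ ⟨h3, rfl⟩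
    ⟨h4, rfl⟩ ⟨h5, rfl⟩
  have e := congrFun hs (p, q, r)
  have e' := hw p q r
  simp only [onFst, onSnd, Function.comp, h1, h2, h3, h4, h5, Prod.mk.injEq] at e e'
  exact ⟨e.1.symm, _, ⟨e.2.symm, rfl⟩, e'.symm⟩

/-- A strand crossing from left to right by crossings of type `S` is the same as a strand crossing
from right to left by inverse crossings, read backwards. -/
theorem CrossingRel.inv_slides_ofMap {S ρ : X × X → X × X} {f w : X × X → H}
    (hS : Function.Injective S)
    (hs : onSnd S ∘ onFst S ∘ onSnd ρ = onFst ρ ∘ onSnd S ∘ onFst S)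
    (hw : ∀ x y z, w (y, z) * f (x, (ρ (y, z)).1) * f ((S (x, (ρ (y, z)).1)).2, (ρ (y, z)).2) =
      f (x, y) * f ((S (x, y)).2, z) * w ((S (x, y)).1, (S ((S (x, y)).2, z)).1)) :
    (CrossingRel.ofMap S f).inv.Slides (CrossingRel.ofMap ρ w) := by
  rintro p q r p' q' r₁ q'' r₂ p'' s₁ q₁ s₂ p₁ g₁ g₂ g₃ g₄ g₅ ⟨h1, rfl⟩ ⟨h2, e2⟩ ⟨h3, e3⟩
    ⟨h4, e4⟩ ⟨h5, e5⟩
  have e := congrFun hs (s₂, p₁, q₁)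
  have e' := hw s₂ p₁ q₁
  simp only [onFst, onSnd, Function.comp, h1, h4, h5, Prod.mk.injEq] at e e'
  have k1 := hS (e.2.trans h2.symm)
  simp only [Prod.mk.injEq] at k1
  have k2 := hS ((Prod.ext e.1 k1.1).trans h3.symm)
  simp only [Prod.mk.injEq] at k2
  refine ⟨k2.1, _, ⟨Prod.ext k2.2 k1.2, rfl⟩, ?_⟩
  rw [k1.1, k1.2, k2.1, k2.2, e2, e3, ← k2.1, e4, e5] at e'
  apply Additive.ofMul.injective
  replace e' := congrArg Additive.ofMul e'
  simp only [ofMul_mul, ofMul_inv] at e' ⊢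
  linear_combination (norm := abel) -e'

/-! ### Strands sliding across a crossing, in all orientations -/

section Triangle

/- The lemmas `of_…` transform one of the two triangles into the other, and the lemmas `of_…_symm`
go in the opposite direction. The arcs of the first strand are `x, x₁, x'`, those of the second strand
are `y, y₁, y'`, and those of the sliding strand are `z, z₁, z'`, in the order in which the strand
runs through them. -/

variable {S R : CrossingRel X H} {x y z x₁ y₁ z₁ x' y' z' : X} {g₁ g₂ g₃ : H}

/-- The sliding strand comes in on the right of both strands of the crossing `R`. -/
theorem CrossingRel.Slides.of_right (h : S.Slides R) (hS : S.IsSwitch)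
    (h1 : R x y y₁ x₁ g₁) (h2 : S x₁ z z₁ x' g₂) (h3 : S y₁ z₁ z' y' g₃) :
    ∃ x₁ y₁ z₁ k₁ k₂ k₃, R x₁ y₁ y' x' k₁ ∧ S x z₁ z' x₁ k₂ ∧ S y z z₁ y₁ k₃ ∧
      g₁ * g₂ * g₃ = k₁ * k₂ * k₃ := by
  obtain ⟨s, q, k, h4⟩ := hS.exists_upper y z
  obtain ⟨t, p, l, h5⟩ := hS.exists_upper x s
  obtain ⟨rfl, m, h6, e⟩ := h h1 h2 h3 h4 h5
  exact ⟨_, _, _, _, _, _, h6, h5, h4, by rw [e]; ac_rfl⟩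

theorem CrossingRel.Slides.of_right_symm (h : S.Slides R) (hS : S.IsSwitch) (hR : R.IsSwitch)
    (h1 : R x₁ y₁ y' x' g₁) (h2 : S x z₁ z' x₁ g₂) (h3 : S y z z₁ y₁ g₃) :
    ∃ x₁ y₁ z₁ k₁ k₂ k₃, R x y y₁ x₁ k₁ ∧ S x₁ z z₁ x' k₂ ∧ S y₁ z₁ z' y' k₃ ∧
      g₁ * g₂ * g₃ = k₁ * k₂ * k₃ := by
  obtain ⟨p, q, k, h4⟩ := hR.exists_upper x y
  obtain ⟨r, q', l, h5⟩ := hS.exists_upper q z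
  obtain ⟨s, p', m, h6⟩ := hS.exists_upper p r
  obtain ⟨rfl, n, h7, e⟩ := h h4 h5 h6 h3 h2
  obtain ⟨-, -, rfl, rfl, rfl⟩ := hR.unique h1 h7 (by simp)
  exact ⟨_, _, _, _, _, _, h4, h5, h6, by rw [e]; ac_rfl⟩

/-- The sliding strand comes in on the left of both strands of the crossing `R`. -/
theorem CrossingRel.Slides.of_left (h : S.Slides R) (hS : S.IsSwitch)
    (h1 : R x₁ y₁ y' x' g₁) (h2 : S.inv z x x₁ z₁ g₂) (h3 : S.inv z₁ y y₁ z' g₃) :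
    ∃ x₁ y₁ z₁ k₁ k₂ k₃, R x y y₁ x₁ k₁ ∧ S.inv z₁ x₁ x' z' k₂ ∧ S.inv z y₁ y' z₁ k₃ ∧
      g₁ * g₂ * g₃ = k₁ * k₂ * k₃ := by
  obtain ⟨r, q, k, h4⟩ := hS.exists_upper x' z'
  obtain ⟨s, p, l, h5⟩ := hS.exists_upper y' r
  obtain ⟨rfl, m, h6, e⟩ := h h1 h4 h5 h3 h2
  refine ⟨_, _, _, m, k⁻¹, l⁻¹, h6, inv_of h4, inv_of h5, ?_⟩
  apply Additive.ofMul.injective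
  replace e := congrArg Additive.ofMul e
  simp only [ofMul_mul, ofMul_inv] at e ⊢
  linear_combination (norm := abel) e

theorem CrossingRel.Slides.of_left_symm (h : S.Slides R) (hS : S.IsSwitch) (hR : R.IsSwitch)
    (h1 : R x y y₁ x₁ g₁) (h2 : S.inv z₁ x₁ x' z' g₂) (h3 : S.inv z y₁ y' z₁ g₃) :
    ∃ x₁ y₁ z₁ k₁ k₂ k₃, R x₁ y₁ y' x' k₁ ∧ S.inv z x x₁ z₁ k₂ ∧ S.inv z₁ y y₁ z' k₃ ∧
      g₁ * g₂ * g₃ = k₁ * k₂ * k₃ := by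
  obtain ⟨p, q, k, h4⟩ := hR.exists_lower y' x'
  obtain ⟨s, q₁, l, h5⟩ := hS.exists_upper q z'
  obtain ⟨t, p₁, m, h6⟩ := hS.exists_upper p s
  obtain ⟨rfl, n, h7, e⟩ := h h4 h2 h3 h5 h6
  obtain ⟨rfl, rfl, -, -, rfl⟩ := hR.unique h1 h7 (by simp)
  refine ⟨_, _, _, k, m⁻¹, l⁻¹, h4, inv_of h6, inv_of h5, ?_⟩
  apply Additive.ofMul.injective
  replace e := congrArg Additive.ofMul e
  simp only [ofMul_mul, ofMul_inv] at e ⊢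
  linear_combination (norm := abel) -e

/-- The sliding strand runs downwards between the two strands of the crossing `R`: it comes in on
the right of the first and on the left of the second. -/
theorem CrossingRel.Slides.of_middle (h : S.Slides R) (hS : S.IsSwitch)
    (h1 : R x y₁ y' x₁ g₁) (h2 : S x₁ z₁ z' x' g₂) (h3 : S.inv z y y₁ z₁ g₃) :
    ∃ x₁ y₁ z₁ k₁ k₂ k₃, R x₁ y y₁ x' k₁ ∧ S x z z₁ x₁ k₂ ∧ S.inv z₁ y₁ y' z' k₃ ∧
      g₁ * g₂ * g₃ = k₁ * k₂ * k₃ := by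
  obtain ⟨r, p, k, h4⟩ := hS.exists_upper y' z'
  obtain ⟨s, q, l, h5⟩ := hS.exists_upper x z
  obtain ⟨rfl, m, h6, e⟩ := h h1 h2 h4 h3 h5
  refine ⟨_, _, _, m, l, k⁻¹, h6, h5, inv_of h4, ?_⟩
  apply Additive.ofMul.injective
  replace e := congrArg Additive.ofMul e
  simp only [ofMul_mul, ofMul_inv] at e ⊢
  linear_combination (norm := abel) e

theorem CrossingRel.Slides.of_middle_symm (h : S.Slides R) (hS : S.IsSwitch) (hR : R.IsSwitch)
    (h1 : R x₁ y y₁ x' g₁) (h2 : S x z z₁ x₁ g₂) (h3 : S.inv z₁ y₁ y' z' g₃) :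
    ∃ x₁ y₁ z₁ k₁ k₂ k₃, R x y₁ y' x₁ k₁ ∧ S x₁ z₁ z' x' k₂ ∧ S.inv z y y₁ z₁ k₃ ∧
      g₁ * g₂ * g₃ = k₁ * k₂ * k₃ := by
  obtain ⟨q, r, k, h4⟩ := hS.exists_lower z y
  obtain ⟨p', q', l, h5⟩ := hR.exists_upper x q
  obtain ⟨r₁, q'', m, h6⟩ := hS.exists_upper q' r
  obtain ⟨r₂, p'', n, h7⟩ := hS.exists_upper p' r₁
  obtain ⟨rfl, t, h8, e⟩ := h h5 h6 h7 h4 h2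
  obtain ⟨-, -, rfl, rfl, rfl⟩ := hR.unique h1 h8 (by simp)
  obtain ⟨rfl, rfl, -, -, rfl⟩ := hS.unique h3 h7 (by simp)
  refine ⟨_, _, _, l, m, k⁻¹, h5, h6, inv_of h4, ?_⟩
  apply Additive.ofMul.injective
  replace e := congrArg Additive.ofMul e
  simp only [ofMul_mul, ofMul_inv] at e ⊢
  linear_combination (norm := abel) -e

/-- The sliding strand comes in on the left of the first and on the right of the second strand of
`R`, so the three strands run around the triangle. -/
theorem CrossingRel.Slides.of_cyclic (h : S.Slides R) (hS : S.IsSwitch)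
    (h1 : R x₁ y y₁ x' g₁) (h2 : S.inv z₁ x x₁ z' g₂) (h3 : S y₁ z z₁ y' g₃) :
    ∃ x₁ y₁ z₁ k₁ k₂ k₃, R x y₁ y' x₁ k₁ ∧ S.inv z x₁ x' z₁ k₂ ∧ S y z₁ z' y₁ k₃ ∧
      g₁ * g₂ * g₃ = k₁ * k₂ * k₃ := by
  obtain ⟨r, q₁, k, h4⟩ := hS.exists_left y z'
  obtain ⟨r₁, q'', l, h5⟩ := hS.exists_upper x' r
  obtain ⟨r₂, p'', m, h6⟩ := hS.exists_upper y₁ r₁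
  obtain ⟨rfl, n, h7, e⟩ := h h1 h5 h6 h4 h2
  obtain ⟨-, rfl, -, rfl, rfl⟩ := hS.unique h3 h6 (by simp)
  refine ⟨_, _, _, n, l⁻¹, k, h7, inv_of h5, h4, ?_⟩
  apply Additive.ofMul.injective
  replace e := congrArg Additive.ofMul e
  simp only [ofMul_mul, ofMul_inv] at e ⊢
  linear_combination (norm := abel) e

theorem CrossingRel.Slides.of_cyclic_symm (h : S.Slides R) (hS : S.IsSwitch) (hR : R.IsSwitch)
    (h1 : R x y₁ y' x₁ g₁) (h2 : S.inv z x₁ x' z₁ g₂) (h3 : S y z₁ z' y₁ g₃) :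
    ∃ x₁ y₁ z₁ k₁ k₂ k₃, R x₁ y y₁ x' k₁ ∧ S.inv z₁ x x₁ z' k₂ ∧ S y₁ z z₁ y' k₃ ∧
      g₁ * g₂ * g₃ = k₁ * k₂ * k₃ := by
  obtain ⟨p, s, k, h4⟩ := hS.exists_right z' x
  obtain ⟨p', q', l, h5⟩ := hR.exists_upper p y
  obtain ⟨r₁, q'', m, h6⟩ := hS.exists_upper q' z₁
  obtain ⟨r₂, p'', n, h7⟩ := hS.exists_upper p' r₁
  obtain ⟨rfl, t, h8, e⟩ := h h5 h6 h7 h3 h4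
  obtain ⟨-, -, rfl, rfl, rfl⟩ := hR.unique h1 h8 (by simp)
  obtain ⟨rfl, -, rfl, -, rfl⟩ := hS.unique h2 h6 (by simp)
  refine ⟨_, _, _, l, k⁻¹, n, h5, inv_of h4, h7, ?_⟩
  apply Additive.ofMul.injective
  replace e := congrArg Additive.ofMul e
  simp only [ofMul_mul, ofMul_inv] at e ⊢
  linear_combination (norm := abel) -e

end Triangle

/-! ### Moving a classical crossing across a singular one -/

section Flip

/-- Crossings of types `S` and `T` that face each other with their right sides, so that their two
strands run in opposite directions, can be interchanged: the crossing `T` is flipped, and `S` moves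
from one side of it to the other. -/
def CrossingRel.FlipsRight (S T : CrossingRel X H) : Prop :=
  ∀ ⦃a b a₁ b₁ a' b' g₁ g₂⦄, S a b₁ b' a₁ g₁ → T b a₁ a' b₁ g₂ →
    ∃ a₁ b₁ k₁ k₂, T a b₁ b' a₁ k₁ ∧ S b a₁ a' b₁ k₂ ∧ g₁ * g₂ = k₁ * k₂

/-- Crossings of types `S` and `T` one above the other can be interchanged. -/
def CrossingRel.Commutes (S T : CrossingRel X H) : Prop :=
  ∀ ⦃a b c d c' d' p q g₁ g₂ g₃⦄, S a b c d g₁ → T c d p q g₂ → T a b c' d' g₃ →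
    ∃ g₄, S c' d' p q g₄ ∧ g₁ * g₂ = g₃ * g₄

theorem CrossingRel.Commutes.inv {S T : CrossingRel X H} (h : S.Commutes T) :
    S.inv.Commutes T := by
  intro a b c d c' d' p q g₁ g₂ g₃ h1 h2 h3
  obtain ⟨g₄, h4, e⟩ := h h1 h3 h2
  refine ⟨g₄⁻¹, inv_of h4, ?_⟩
  rw [eq_mul_inv_iff_mul_eq, mul_assoc, ← e]
  simp

/-- Every color occurs on the loop and on the rest of a kink whose crossing has trivial weight and
whose strand comes out with the color with which it came in. -/
structure CrossingRel.HasKinks (S : CrossingRel X H) : Prop where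
  exists_right : ∀ x, ∃ y, S x y x y 1
  exists_left : ∀ y, ∃ x, S x y x y 1

theorem CrossingRel.HasKinks.inv {S : CrossingRel X H} (h : S.HasKinks) : S.inv.HasKinks where
  exists_right x := by simpa [CrossingRel.inv] using h.exists_right x
  exists_left x := by simpa [CrossingRel.inv] using h.exists_left x

/-- An auxiliary strand of color `w` is added, whose first crossing is a kink of trivial weight with
the strand of color `p`. If `S` is positive, sliding it under the crossings `T p q r t` and
`S r t a' b₁` relates the given pair of crossings to the crossing `T w b r' t'`. Sliding another
strand over the latter gives the flipped pair, up to a crossing of that strand with one of color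
`t'`, which again is a kink. -/
theorem CrossingRel.flipsRight {S T : CrossingRel X H} (hS : S.IsSwitch) (hT : T.IsSwitch)
    (hk : S.HasKinks) (hc : S.Commutes T) (hST : S.Slides T) (hST' : S.inv.Slides T)
    (hSS : S.Slides S) : S.FlipsRight T := by
  intro a b a₁ b₁ a' b' g₁ g₂ h1 h2
  obtain ⟨p, q, g₃, h3⟩ := hS.exists_lower b a₁
  obtain ⟨r, t, g₄, h4⟩ := hT.exists_upper p q
  obtain ⟨g₅, h5, e1⟩ := hc h3 h2 h4
  -- the auxiliary strand slides across `T p q r t`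
  obtain ⟨w, hw⟩ := hk.exists_left p
  obtain ⟨r', t', g₆, h6⟩ := hT.exists_upper w b
  obtain ⟨w', t₁, g₇, h7⟩ := hS.exists_lower t' a₁
  obtain ⟨w₁, r₁, g₈, h8⟩ := hS.exists_lower r' w'
  obtain ⟨rfl, g₉, h9, e2⟩ := hST' h6 (inv_of h7) (inv_of h8) (inv_of h3) (inv_of hw)
  obtain ⟨-, -, rfl, rfl, rfl⟩ := hT.unique h4 h9 (by simp)
  -- the auxiliary strand slides across `S r t a' b₁`
  obtain ⟨u, y, g₁₀, h10⟩ := hS.exists_upper r' t'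
  obtain ⟨u', v, g₁₁, h11⟩ := hS.exists_upper w a'
  obtain ⟨rfl, g₁₂, h12, e3⟩ := hSS h8 h7 h10 h5 h11
  obtain ⟨rfl, -, rfl, -, rfl⟩ := hS.unique h1 h12 (by simp)
  -- a strand of initial color `a₂` slides across `T w b r' t'`, and its first crossing is a kink
  obtain ⟨a₂, b₂, k₂, h13⟩ := hS.exists_left b a'
  obtain ⟨α, β, k₃, h14⟩ := hS.exists_upper t' a₂
  obtain ⟨γ, δ, k₄, h15⟩ := hS.exists_upper r' α
  obtain ⟨rfl, k₁, h16, e4⟩ := hST h6 h14 h15 h13 h11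
  obtain ⟨-, rfl, -, rfl, rfl⟩ := hS.unique h10 h15 (by simp)
  obtain ⟨s, hs⟩ := hk.exists_right t'
  obtain ⟨-, rfl, -, rfl, rfl⟩ := hS.unique hs h14 (by simp)
  refine ⟨_, _, k₁, k₂, h16, h13, ?_⟩
  apply Additive.ofMul.injective
  replace e1 := congrArg Additive.ofMul e1
  replace e2 := congrArg Additive.ofMul e2
  replace e3 := congrArg Additive.ofMul e3
  replace e4 := congrArg Additive.ofMul e4
  simp only [ofMul_mul, ofMul_inv, ofMul_one] at e1 e2 e3 e4 ⊢
  linear_combination (norm := abel) e1 - e2 - e3 + e4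

/-- The analogue of `FlipsRight` for the inverse of `S` and crossings that face each other with
their left sides: the crossing of type `S` is cancelled by its inverse on either side of the flip. -/
theorem CrossingRel.FlipsRight.inv_left {S T : CrossingRel X H} (hT : T.IsSwitch)
    (h : S.FlipsRight T) {a b a₁ b₁ a' b' : X} {g₁ g₂ : H}
    (h1 : S.inv b₁ a a₁ b' g₁) (h2 : T a₁ b b₁ a' g₂) :
    ∃ a₁ b₁ k₁ k₂, T b₁ a a₁ b' k₁ ∧ S.inv a₁ b b₁ a' k₂ ∧ g₁ * g₂ = k₁ * k₂ := by
  obtain ⟨c, d, k, h3⟩ := hT.exists_right a b'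
  obtain ⟨p, q, l, m, h4, h5, e⟩ := h h1 h3
  obtain ⟨-, rfl, -, rfl, rfl⟩ := hT.unique h2 h4 (by simp)
  refine ⟨_, _, k, m⁻¹, h3, inv_of h5, ?_⟩
  apply Additive.ofMul.injective
  replace e := congrArg Additive.ofMul e
  simp only [ofMul_mul, ofMul_inv] at e ⊢
  linear_combination (norm := abel) -e

end Flip

end WeightedSwitch

/-! ### The crossing relations of a singular pair with a cocycle pair -/

section System

variable {X H : Type*} [CommGroup H]

/-- A choice of crossing relations for all kinds of crossings that is compatible with the moves. -/
structure IsInvariantSystem (K : Kind → CrossingRel X H) : Prop where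
  inv : ∀ p, K (.classical !p) = (K (.classical p)).inv
  isSwitch : ∀ k, (K k).IsSwitch
  slides : ∀ p k, (K (.classical p)).Slides (K k)
  commutes : ∀ p, (K (.classical p)).Commutes (K .singular)
  hasKinks : ∀ p, (K (.classical p)).HasKinks

/-- The coloring rule at a crossing together with its Boltzmann weight. -/
def Kind.rel (S τ : X × X → X × X) (f h : X × X → H) (k : Kind) : CrossingRel X H :=
  fun a b c d g => k.Rule S τ (a, b) (c, d) ∧ k.weight f h (a, b) (c, d) = g

theorem Kind.rel_negative (S τ : X × X → X × X) (f h : X × X → H) :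
    Kind.rel S τ f h (.classical false) = (CrossingRel.ofMap S f).inv := by
  funext a b c d g
  simp [Kind.rel, Kind.Rule, Kind.weight, CrossingRel.inv, CrossingRel.ofMap, eq_comm,
    inv_eq_iff_eq_inv]

theorem Kind.rel_positive (S τ : X × X → X × X) (f h : X × X → H) :
    Kind.rel S τ f h (.classical true) = CrossingRel.ofMap S f := by
  funext a b c d g
  simp [Kind.rel, Kind.Rule, Kind.weight, CrossingRel.ofMap, eq_comm]

theorem Kind.rel_singular (S τ : X × X → X × X) (f h : X × X → H) :
    Kind.rel S τ f h .singular = CrossingRel.ofMap τ h := by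
  funext a b c d g
  simp [Kind.rel, Kind.Rule, Kind.weight, CrossingRel.ofMap, eq_comm]

theorem isInvariantSystem_rel {S τ : X × X → X × X} {f h : X × X → H} (hS : IsSingularPair S τ)
    (hf : IsAbelianCocyclePair S τ f h) : IsInvariantSystem (Kind.rel S τ f h) := by
  have hB := hS.biquandle.toIsBirack
  have sS : (CrossingRel.ofMap S f).IsSwitch :=
    CrossingRel.isSwitch_ofMap hB.bijective hB.left_inv hB.right_inv f
  have sτ : (CrossingRel.ofMap τ h).IsSwitch :=
    CrossingRel.isSwitch_ofMap hS.bijective hS.left_inv hS.right_inv h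
  have slS : (CrossingRel.ofMap S f).Slides (CrossingRel.ofMap S f) :=
    CrossingRel.slides_ofMap hB.yangBaxter.symm fun x y z => by
      rw [hf.cocycle x y z]
      ac_rfl
  have slS' : (CrossingRel.ofMap S f).inv.Slides (CrossingRel.ofMap S f) :=
    CrossingRel.inv_slides_ofMap hB.bijective.1 hB.yangBaxter fun x y z => by
      rw [hf.cocycle x y z]
      ac_rfl
  have slτ : (CrossingRel.ofMap S f).Slides (CrossingRel.ofMap τ h) :=
    CrossingRel.slides_ofMap hS.slide_left hf.compat_left
  have slτ' : (CrossingRel.ofMap S f).inv.Slides (CrossingRel.ofMap τ h) :=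
    CrossingRel.inv_slides_ofMap hB.bijective.1 hS.slide_right hf.compat_right
  have co : (CrossingRel.ofMap S f).Commutes (CrossingRel.ofMap τ h) := by
    rintro a b c d c' d' p q _ _ _ ⟨h1, rfl⟩ ⟨h2, rfl⟩ ⟨h3, rfl⟩
    have e := congrFun hS.comm (a, b)
    have e' := hf.compat_comm a b
    simp only [Function.comp, h1, h2, h3] at e e'
    exact ⟨_, ⟨e.symm, rfl⟩, e'⟩
  have ki : (CrossingRel.ofMap S f).HasKinks := by
    obtain ⟨s, hs⟩ := hS.biquandle.fixedPoints
    constructor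
    · intro x
      have := (hs x (s x)).2 rfl
      exact ⟨s x, this, hf.fixed _ _ this⟩
    · intro y
      have := (hs (s.symm y) y).2 (by simp)
      exact ⟨s.symm y, this, hf.fixed _ _ this⟩
  constructor
  · rintro (_ | _) <;> simp [Kind.rel_negative, Kind.rel_positive]
  · rintro ((_ | _) | _) <;>
      simp [Kind.rel_negative, Kind.rel_positive, Kind.rel_singular, sS, sτ, sS.inv]
  · rintro (_ | _) ((_ | _) | _) <;>
      simp only [Kind.rel_negative, Kind.rel_positive, Kind.rel_singular] <;>
      first
      | assumption
      | exact slS.inv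
      | exact slS'.inv
  · rintro (_ | _) <;> simp only [Kind.rel_negative, Kind.rel_positive, Kind.rel_singular]
    exacts [co.inv, co]
  · rintro (_ | _) <;> simp only [Kind.rel_negative, Kind.rel_positive]
    exacts [ki.inv, ki]

end System

/-! ### States of tangles -/

section States

variable {X H : Type*} {σ : Type}

/-- The coloring `c` of the semi-arcs obeys the relations at all crossings, where `g` are the
weights of the crossings. -/
def Tangle.IsState (K : Kind → CrossingRel X H) (T : Tangle σ) (c : T.E → X) (g : T.V → H) : Prop :=
  ∀ v, K (T.kind v) (c (T.inn v .left)) (c (T.inn v .right)) (c (T.out v .left))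
    (c (T.out v .right)) (g v)

/-- A state of `T` is determined by its colors on the boundary. -/
def Tangle.IsDetermined (K : Kind → CrossingRel X H) (T : Tangle σ) : Prop :=
  ∀ c g c' g', T.IsState K c g → T.IsState K c' g' →
    (∀ i, c (T.tail (.inl i)) = c' (T.tail (.inl i))) →
    (∀ i, c (T.head (.inl i)) = c' (T.head (.inl i))) → c = c'

variable {K : Kind → CrossingRel X H}

/-- Each crossing has boundary semi-arcs on both of its strands, hence at one of its corners. -/
theorem isDetermined_ofPasses_two [Finite σ] {V : Type} [Fintype V] (hK : ∀ k, (K k).IsSwitch)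
    (kind : V → Kind) (pass : V × Side → σ × Fin 2) (hpass : Function.Bijective pass) :
    (Tangle.ofPasses kind pass hpass).IsDetermined K := by
  intro c g c' g' hc hc' ht hh
  change σ × Fin 3 → X at c c'
  replace ht : ∀ i, c (i, 0) = c' (i, 0) := ht
  replace hh : ∀ i, c (i, 2) = c' (i, 2) := hh
  -- a strand has its only inner semi-arc between its two passages
  have outer : ∀ q, c ((pass q).1, (pass q).2.castSucc) = c' ((pass q).1, (pass q).2.castSucc) ∨
      c ((pass q).1, (pass q).2.succ) = c' ((pass q).1, (pass q).2.succ) := by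
    intro q
    generalize pass q = r
    obtain ⟨i, j⟩ := r
    fin_cases j
    exacts [.inl (ht i), .inr (hh i)]
  have key : ∀ v, _ := fun v : V => (hK _).unique (hc v) (hc' v) (by
    change (c ((pass (v, .left)).1, (pass (v, .left)).2.castSucc) =
          c' ((pass (v, .left)).1, (pass (v, .left)).2.castSucc) ∧
        c ((pass (v, .right)).1, (pass (v, .right)).2.castSucc) =
          c' ((pass (v, .right)).1, (pass (v, .right)).2.castSucc)) ∨
      (c ((pass (v, .right)).1, (pass (v, .right)).2.succ) =
          c' ((pass (v, .right)).1, (pass (v, .right)).2.succ) ∧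
        c ((pass (v, .left)).1, (pass (v, .left)).2.succ) =
          c' ((pass (v, .left)).1, (pass (v, .left)).2.succ)) ∨
      (c ((pass (v, .left)).1, (pass (v, .left)).2.castSucc) =
          c' ((pass (v, .left)).1, (pass (v, .left)).2.castSucc) ∧
        c ((pass (v, .right)).1, (pass (v, .right)).2.succ) =
          c' ((pass (v, .right)).1, (pass (v, .right)).2.succ)) ∨
      (c ((pass (v, .right)).1, (pass (v, .right)).2.castSucc) =
          c' ((pass (v, .right)).1, (pass (v, .right)).2.castSucc) ∧
        c ((pass (v, .left)).1, (pass (v, .left)).2.succ) =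
          c' ((pass (v, .left)).1, (pass (v, .left)).2.succ))
    have := outer (v, .left)
    have := outer (v, .right)
    tauto)
  have inner : ∀ i, c (i, 1) = c' (i, 1) := by
    intro i
    obtain ⟨⟨v, s⟩, hq⟩ := hpass.2 (i, 1)
    have e : (i, (1 : Fin 3)) = ((pass (v, s)).1, (pass (v, s)).2.castSucc) := by rw [hq]; rfl
    rw [e]
    cases s
    exacts [(key v).1, (key v).2.1]
  funext ⟨i, j⟩
  fin_cases j
  exacts [ht i, inner i, hh i]

theorem isDetermined_parallelStrands [Finite σ] : (parallelStrands σ).IsDetermined K := by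
  intro c g c' g' _ _ ht _
  funext ⟨i, j⟩
  obtain rfl : j = 0 := Fin.fin_one_eq_zero j
  exact ht i

/-- The coloring `c` of the semi-arcs of a tangle in which every strand has two passages, changed to
`x` on the inner semi-arcs. -/
def setInner (c : σ × Fin 3 → X) (x : σ → X) : σ × Fin 3 → X :=
  fun q => if q.2 = 1 then x q.1 else c q

theorem isState_triangle {l01 l02 l12 o e : Bool} {k : Kind} {c : Fin 3 × Fin 3 → X}
    {g₀ g₁ g₂ : H}
    (h0 : let T := triangle l01 l02 l12 o k e
      K k (c (T.inn (0 : Fin 3) .left)) (c (T.inn (0 : Fin 3) .right))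
        (c (T.out (0 : Fin 3) .left)) (c (T.out (0 : Fin 3) .right)) g₀)
    (h1 : let T := triangle l01 l02 l12 o k e
      K (.classical (l02 == o)) (c (T.inn (1 : Fin 3) .left)) (c (T.inn (1 : Fin 3) .right))
        (c (T.out (1 : Fin 3) .left)) (c (T.out (1 : Fin 3) .right)) g₁)
    (h2 : let T := triangle l01 l02 l12 o k e
      K (.classical (l12 == o)) (c (T.inn (2 : Fin 3) .left)) (c (T.inn (2 : Fin 3) .right))
        (c (T.out (2 : Fin 3) .left)) (c (T.out (2 : Fin 3) .right)) g₂) :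
    (triangle l01 l02 l12 o k e).IsState K c ![g₀, g₁, g₂] := by
  intro (v : Fin 3)
  fin_cases v
  exacts [h0, h1, h2]

theorem isState_bigon {b : BigonShape} {k k' : Kind} {c : Bool × Fin 3 → X} {g : Bool → H}
    (h0 : let T := bigon b k k'
      K k (c (T.inn false .left)) (c (T.inn false .right)) (c (T.out false .left))
        (c (T.out false .right)) (g false))
    (h1 : let T := bigon b k k'
      K k' (c (T.inn true .left)) (c (T.inn true .right)) (c (T.out true .left))
        (c (T.out true .right)) (g true)) :
    (bigon b k k').IsState K c g := by
  rintro (_ | _)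
  exacts [h0, h1]

variable [CommGroup H]

/-- For any state of `T` there is a state of `T'` with the same colors on the boundary and the same
total weight. -/
def Tangle.Simulates (K : Kind → CrossingRel X H) (T' T : Tangle σ) : Prop :=
  ∀ c g, T.IsState K c g → ∃ c' g', T'.IsState K c' g' ∧
    (∀ i, c' (T'.tail (.inl i)) = c (T.tail (.inl i))) ∧
    (∀ i, c' (T'.head (.inl i)) = c (T.head (.inl i))) ∧ ∏ v, g v = ∏ v, g' v

theorem simulates_triangle (hK : IsInvariantSystem K) (l01 l02 l12 o : Bool) (k : Kind) (e : Bool) :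
    (triangle l01 l02 l12 o k (!e)).Simulates K (triangle l01 l02 l12 o k e) := by
  have pos : ∀ {a b c d g}, K (.classical (true == o)) a b c d g ↔
      K (.classical o) a b c d g := by simp
  have neg : ∀ {a b c d g}, K (.classical (false == o)) a b c d g ↔
      (K (.classical o)).inv a b c d g := by simp [← hK.inv]
  have sl := hK.slides o k
  have swS := hK.isSwitch (.classical o)
  have swR := hK.isSwitch k
  intro c g hc
  change Fin 3 → H at g
  -- it suffices to find the new colors of the inner semi-arcs and the new weights
  suffices h : ∃ x y z k₀ k₁ k₂, (triangle l01 l02 l12 o k (!e)).IsState K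
      (setInner (σ := Fin 3) c ![x, y, z]) ![k₀, k₁, k₂] ∧ g 0 * g 1 * g 2 = k₀ * k₁ * k₂ by
    obtain ⟨x, y, z, k₀, k₁, k₂, h, e⟩ := h
    exact ⟨_, _, h, fun _ => rfl, fun _ => rfl, by
      change ∏ v : Fin 3, g v = ∏ v : Fin 3, _
      rw [Fin.prod_univ_three, Fin.prod_univ_three]
      exact e⟩
  have h0 := hc (0 : Fin 3)
  have h1 := hc (1 : Fin 3)
  have h2 := hc (2 : Fin 3)
  have comm : ∀ {a b c a' b' c' : H}, a * c * b = a' * c' * b' → a * b * c = a' * b' * c' :=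
    fun h => (mul_right_comm _ _ _).trans (h.trans (mul_right_comm _ _ _))
  -- The strand `2` lies on the right of the strands `0` and `1`, on their left, or between them, or
  -- the strands run around the triangle. If `l01 = false`, the strands `0` and `1` swap roles.
  cases l01 <;> cases l02 <;> cases l12 <;> cases e
  · obtain ⟨y, x, z, k₀, k₂, k₁, e0, e2, e1, e⟩ :=
      sl.of_left_symm swS swR h0 (neg.1 h2) (neg.1 h1)
    exact ⟨x, y, z, k₀, k₁, k₂, isState_triangle e0 (neg.2 e1) (neg.2 e2), comm e⟩
  · obtain ⟨y, x, z, k₀, k₂, k₁, e0, e2, e1, e⟩ :=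
      sl.of_left swS h0 (neg.1 h2) (neg.1 h1)
    exact ⟨x, y, z, k₀, k₁, k₂, isState_triangle e0 (neg.2 e1) (neg.2 e2), comm e⟩
  · obtain ⟨y, x, z, k₀, k₂, k₁, e0, e2, e1, e⟩ :=
      sl.of_middle_symm swS swR h0 (pos.1 h2) (neg.1 h1)
    exact ⟨x, y, z, k₀, k₁, k₂, isState_triangle e0 (neg.2 e1) (pos.2 e2), comm e⟩
  · obtain ⟨y, x, z, k₀, k₂, k₁, e0, e2, e1, e⟩ :=
      sl.of_middle swS h0 (pos.1 h2) (neg.1 h1)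
    exact ⟨x, y, z, k₀, k₁, k₂, isState_triangle e0 (neg.2 e1) (pos.2 e2), comm e⟩
  · obtain ⟨y, x, z, k₀, k₂, k₁, e0, e2, e1, e⟩ :=
      sl.of_cyclic_symm swS swR h0 (neg.1 h2) (pos.1 h1)
    exact ⟨x, y, z, k₀, k₁, k₂, isState_triangle e0 (pos.2 e1) (neg.2 e2), comm e⟩
  · obtain ⟨y, x, z, k₀, k₂, k₁, e0, e2, e1, e⟩ :=
      sl.of_cyclic swS h0 (neg.1 h2) (pos.1 h1)
    exact ⟨x, y, z, k₀, k₁, k₂, isState_triangle e0 (pos.2 e1) (neg.2 e2), comm e⟩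
  · obtain ⟨y, x, z, k₀, k₂, k₁, e0, e2, e1, e⟩ :=
      sl.of_right_symm swS swR h0 (pos.1 h2) (pos.1 h1)
    exact ⟨x, y, z, k₀, k₁, k₂, isState_triangle e0 (pos.2 e1) (pos.2 e2), comm e⟩
  · obtain ⟨y, x, z, k₀, k₂, k₁, e0, e2, e1, e⟩ :=
      sl.of_right swS h0 (pos.1 h2) (pos.1 h1)
    exact ⟨x, y, z, k₀, k₁, k₂, isState_triangle e0 (pos.2 e1) (pos.2 e2), comm e⟩
  · obtain ⟨x, y, z, k₀, k₁, k₂, e0, e1, e2, e⟩ :=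
      sl.of_left_symm swS swR h0 (neg.1 h1) (neg.1 h2)
    exact ⟨x, y, z, k₀, k₁, k₂, isState_triangle e0 (neg.2 e1) (neg.2 e2), e⟩
  · obtain ⟨x, y, z, k₀, k₁, k₂, e0, e1, e2, e⟩ :=
      sl.of_left swS h0 (neg.1 h1) (neg.1 h2)
    exact ⟨x, y, z, k₀, k₁, k₂, isState_triangle e0 (neg.2 e1) (neg.2 e2), e⟩
  · obtain ⟨x, y, z, k₀, k₁, k₂, e0, e1, e2, e⟩ :=
      sl.of_cyclic_symm swS swR h0 (neg.1 h1) (pos.1 h2)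
    exact ⟨x, y, z, k₀, k₁, k₂, isState_triangle e0 (neg.2 e1) (pos.2 e2), e⟩
  · obtain ⟨x, y, z, k₀, k₁, k₂, e0, e1, e2, e⟩ :=
      sl.of_cyclic swS h0 (neg.1 h1) (pos.1 h2)
    exact ⟨x, y, z, k₀, k₁, k₂, isState_triangle e0 (neg.2 e1) (pos.2 e2), e⟩
  · obtain ⟨x, y, z, k₀, k₁, k₂, e0, e1, e2, e⟩ :=
      sl.of_middle_symm swS swR h0 (pos.1 h1) (neg.1 h2)
    exact ⟨x, y, z, k₀, k₁, k₂, isState_triangle e0 (pos.2 e1) (neg.2 e2), e⟩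
  · obtain ⟨x, y, z, k₀, k₁, k₂, e0, e1, e2, e⟩ :=
      sl.of_middle swS h0 (pos.1 h1) (neg.1 h2)
    exact ⟨x, y, z, k₀, k₁, k₂, isState_triangle e0 (pos.2 e1) (neg.2 e2), e⟩
  · obtain ⟨x, y, z, k₀, k₁, k₂, e0, e1, e2, e⟩ :=
      sl.of_right_symm swS swR h0 (pos.1 h1) (pos.1 h2)
    exact ⟨x, y, z, k₀, k₁, k₂, isState_triangle e0 (pos.2 e1) (pos.2 e2), e⟩
  · obtain ⟨x, y, z, k₀, k₁, k₂, e0, e1, e2, e⟩ :=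
      sl.of_right swS h0 (pos.1 h1) (pos.1 h2)
    exact ⟨x, y, z, k₀, k₁, k₂, isState_triangle e0 (pos.2 e1) (pos.2 e2), e⟩

end States

/-! ### Bigons, kinks and the local moves -/

section Moves

variable {X H : Type*} [CommGroup H] {K : Kind → CrossingRel X H}

theorem IsInvariantSystem.flipsRight (hK : IsInvariantSystem K) (p : Bool) :
    (K (.classical p)).FlipsRight (K .singular) :=
  CrossingRel.flipsRight (hK.isSwitch _) (hK.isSwitch _) (hK.hasKinks p) (hK.commutes p)
    (hK.slides p _) (hK.inv p ▸ hK.slides (!p) _) (hK.slides p _)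

theorem simulates_bigon_bigon {b : BigonShape} {k₁ k₁' k₂ k₂' : Kind}
    (h : ∀ c g, (bigon b k₁ k₁').IsState K c g → ∃ x y l l',
      (bigon b k₂ k₂').IsState K (setInner c fun i => bif i then y else x)
        (fun v => bif v then l' else l) ∧ g false * g true = l * l') :
    (bigon b k₂ k₂').Simulates K (bigon b k₁ k₁') := by
  intro c g hc
  obtain ⟨x, y, l, l', h, e⟩ := h c g hc
  change Bool → H at g
  refine ⟨_, _, h, fun _ => rfl, fun _ => rfl, ?_⟩
  change ∏ v : Bool, g v = ∏ v : Bool, _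
  rw [Fintype.prod_bool, Fintype.prod_bool, mul_comm, e, mul_comm]
  rfl

theorem simulates_bigon_singular_classical (hK : IsInvariantSystem K) (b : BigonShape) (p : Bool) :
    (bigon b .singular (.classical p)).Simulates K (bigon b (.classical p) .singular) := by
  have sT := hK.isSwitch .singular
  refine simulates_bigon_bigon fun c g hc => ?_
  have h0 := hc false
  have h1 := hc true
  cases b
  · obtain ⟨y, x, l, h3⟩ := sT.exists_upper (c (false, 0)) (c (true, 0))
    obtain ⟨l', h4, e⟩ := hK.commutes p h0 h1 h3
    exact ⟨x, y, l, l', isState_bigon h3 h4, e⟩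
  · obtain ⟨x, y, l, l', h3, h4, e⟩ := hK.flipsRight p h0 h1
    exact ⟨x, y, l, l', isState_bigon h3 h4, e⟩
  · have hf := hK.flipsRight !p
    have hi : ∀ {a b c d g}, K (.classical p) a b c d g ↔ (K (.classical !p)).inv a b c d g := by
      simp [← hK.inv]
    obtain ⟨x, y, l, l', h3, h4, e⟩ := hf.inv_left sT (hi.1 h0) h1
    exact ⟨x, y, l, l', isState_bigon h3 (hi.2 h4), e⟩

theorem simulates_bigon_classical_singular (hK : IsInvariantSystem K) (b : BigonShape) (p : Bool) :
    (bigon b (.classical p) .singular).Simulates K (bigon b .singular (.classical p)) := by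
  have sS := hK.isSwitch (.classical p)
  have sT := hK.isSwitch .singular
  refine simulates_bigon_bigon fun c g hc => ?_
  have h0 := hc false
  have h1 := hc true
  cases b
  · obtain ⟨y, x, l, h3⟩ := sS.exists_upper (c (false, 0)) (c (true, 0))
    obtain ⟨_, _, l', h4⟩ := sT.exists_upper y x
    obtain ⟨_, h5, e⟩ := hK.commutes p h3 h4 h0
    obtain ⟨-, -, rfl, rfl, rfl⟩ := sS.unique h1 h5 (.inl ⟨rfl, rfl⟩)
    exact ⟨x, y, l, l', isState_bigon h3 h4, e.symm⟩
  · obtain ⟨y, x, l, l', h3, h4, e⟩ := hK.flipsRight p h1 h0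
    exact ⟨x, y, l', l, isState_bigon h4 h3, by rw [mul_comm, e, mul_comm]⟩
  · have hf := hK.flipsRight !p
    have hi : ∀ {a b c d g}, K (.classical p) a b c d g ↔ (K (.classical !p)).inv a b c d g := by
      simp [← hK.inv]
    obtain ⟨y, x, l, l', h3, h4, e⟩ := hf.inv_left sT (hi.1 h1) h0
    exact ⟨x, y, l', l, isState_bigon (hi.2 h4) h3, by rw [mul_comm, e, mul_comm]⟩

theorem simulates_bigon_parallelStrands (hK : IsInvariantSystem K) (b : BigonShape) (p : Bool) :
    (bigon b (.classical p) (.classical !p)).Simulates K (parallelStrands Bool) := by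
  have sS := hK.isSwitch (.classical p)
  intro c g _
  change Empty → H at g
  change Bool × Fin 1 → X at c
  suffices h : ∃ x y l, (bigon b (.classical p) (.classical !p)).IsState K
      (fun q => if q.2 = 1 then (bif q.1 then y else x) else c (q.1, 0))
      (fun v => bif v then l⁻¹ else l) by
    obtain ⟨x, y, l, h⟩ := h
    refine ⟨_, _, h, fun _ => rfl, fun _ => rfl, ?_⟩
    change ∏ v : Empty, g v = ∏ v : Bool, _
    simp
  cases b
  · obtain ⟨y, x, l, h⟩ := sS.exists_upper (c (false, 0)) (c (true, 0))
    exact ⟨x, y, l, isState_bigon h (hK.inv p ▸ CrossingRel.inv_of h)⟩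
  · obtain ⟨y, x, l, h⟩ := sS.exists_left (c (false, 0)) (c (true, 0))
    exact ⟨x, y, l, isState_bigon h (hK.inv p ▸ CrossingRel.inv_of h)⟩
  · obtain ⟨y, x, l, h⟩ := sS.exists_right (c (false, 0)) (c (true, 0))
    exact ⟨x, y, l, isState_bigon h (hK.inv p ▸ CrossingRel.inv_of h)⟩

theorem simulates_parallelStrands_bigon (hK : IsInvariantSystem K) (b : BigonShape) (p : Bool) :
    (parallelStrands Bool).Simulates K (bigon b (.classical p) (.classical !p)) := by
  have sS := hK.isSwitch (.classical p)
  intro c g hc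
  change Bool × Fin 3 → X at c
  change Bool → H at g
  suffices h : c (false, 0) = c (false, 2) ∧ c (true, 0) = c (true, 2) ∧ g false = (g true)⁻¹ by
    refine ⟨fun q => c (q.1, 0), fun v => v.elim, fun v => v.elim, fun _ => rfl, ?_, ?_⟩
    · rintro (_ | _)
      exacts [h.1, h.2.1]
    · change ∏ v : Bool, g v = ∏ v : Empty, _
      simp [h.2.2]
  have h0 := hc false
  have h1 : (K (.classical p)).inv _ _ _ _ _ := hK.inv p ▸ hc true
  cases b
  · obtain ⟨h3, h4, -, -, h5⟩ := sS.unique h0 h1 (.inr (.inl ⟨rfl, rfl⟩))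
    exact ⟨h3, h4, h5⟩
  · obtain ⟨h3, -, h4, -, h5⟩ := sS.unique h0 h1 (.inr (.inr (.inr ⟨rfl, rfl⟩)))
    exact ⟨h3, h4.symm, h5⟩
  · obtain ⟨-, h3, -, h4, h5⟩ := sS.unique h0 h1 (.inr (.inr (.inl ⟨rfl, rfl⟩)))
    exact ⟨h3, h4.symm, h5⟩

theorem simulates_kink_parallelStrands (hK : IsInvariantSystem K) (p : Bool) (s : Side) :
    (kink p s).Simulates K (parallelStrands Unit) := by
  intro c g _
  change Empty → H at g
  change Unit × Fin 1 → X at c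
  suffices h : ∃ x, (kink p s).IsState K (fun q => if q.2 = 1 then x else c (q.1, 0)) fun _ => 1 by
    obtain ⟨x, h⟩ := h
    refine ⟨_, _, h, fun _ => rfl, fun _ => rfl, ?_⟩
    change ∏ v : Empty, g v = ∏ v : Unit, _
    simp
  cases s
  · obtain ⟨x, h⟩ := (hK.hasKinks p).exists_right (c ((), 0))
    exact ⟨x, fun _ => h⟩
  · obtain ⟨x, h⟩ := (hK.hasKinks p).exists_left (c ((), 0))
    exact ⟨x, fun _ => h⟩

theorem simulates_parallelStrands_kink (hK : IsInvariantSystem K) (p : Bool) (s : Side) :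
    (parallelStrands Unit).Simulates K (kink p s) := by
  have sS := hK.isSwitch (.classical p)
  intro c g hc
  change Unit × Fin 3 → X at c
  change Unit → H at g
  suffices h : c ((), 0) = c ((), 2) ∧ g () = 1 by
    refine ⟨fun q => c (q.1, 0), fun v => v.elim, fun v => v.elim, fun _ => rfl, ?_, ?_⟩
    · rintro ⟨⟩
      exact h.1
    · change ∏ v : Unit, g v = ∏ v : Empty, _
      simp [h.2]
  have h0 := hc ()
  cases s
  · obtain ⟨x, h⟩ := (hK.hasKinks p).exists_left (c ((), 1))
    obtain ⟨h1, -, h2, -, h3⟩ := sS.unique h0 h (.inr (.inr (.inr ⟨rfl, rfl⟩)))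
    exact ⟨h1.trans h2.symm, h3⟩
  · obtain ⟨x, h⟩ := (hK.hasKinks p).exists_right (c ((), 1))
    obtain ⟨-, h1, -, h2, h3⟩ := sS.unique h0 h (.inr (.inr (.inl ⟨rfl, rfl⟩)))
    exact ⟨h1.trans h2.symm, h3⟩

theorem LocalMove.simulates (hK : IsInvariantSystem K) {σ : Type} {T T' : Tangle σ}
    (m : LocalMove T T') : T'.Simulates K T ∧ T.Simulates K T' := by
  cases m with
  | RI p s => exact ⟨simulates_kink_parallelStrands hK p s, simulates_parallelStrands_kink hK p s⟩
  | RII b p =>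
    exact ⟨simulates_bigon_parallelStrands hK b p, simulates_parallelStrands_bigon hK b p⟩
  | RIII l01 l02 l12 o p =>
    exact ⟨simulates_triangle hK l01 l02 l12 o _ true, simulates_triangle hK l01 l02 l12 o _ false⟩
  | RIV l01 l02 l12 o =>
    exact ⟨simulates_triangle hK l01 l02 l12 o _ true, simulates_triangle hK l01 l02 l12 o _ false⟩
  | RV b p =>
    exact ⟨simulates_bigon_singular_classical hK b p, simulates_bigon_classical_singular hK b p⟩

theorem LocalMove.isDetermined (hK : IsInvariantSystem K) {σ : Type} {T T' : Tangle σ}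
    (m : LocalMove T T') : T.IsDetermined K ∧ T'.IsDetermined K := by
  have hs := hK.isSwitch
  cases m <;>
    exact ⟨by first
        | exact isDetermined_parallelStrands
        | exact isDetermined_ofPasses_two hs _ _ _,
      isDetermined_ofPasses_two hs _ _ _⟩

end Moves

/-! ### Gluings of tangles -/

section Gluing

variable {X H : Type*} {σ : Type}

theorem exists_equiv_of_existsUnique {α β : Type*} {r : α → β → Prop} (h : ∀ a, ∃! b, r a b)
    (h' : ∀ b, ∃! a, r a b) : ∃ φ : α ≃ β, ∀ a, r a (φ a) := by
  choose F hF hF' using h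
  choose G hG hG' using h'
  exact ⟨⟨F, G, fun a => (hG' _ _ (hF a)).symm, fun b => (hF' _ _ (hG b)).symm⟩, hF⟩

/-- Colors on the two parts of a gluing that agree along the boundary fit together. -/
theorem exists_glued_colors {O T : Tangle σ} {D : Diagram} {e : O.E ⊕ T.E → D.E}
    (hs : Function.Surjective e) (he : ∀ a b, e a = e b ↔ Relation.EqvGen (GlueRel O T) a b)
    (c : O.E → X) (c' : T.E → X) (ht : ∀ i, c' (T.tail (.inl i)) = c (O.head (.inl i)))
    (hh : ∀ i, c' (T.head (.inl i)) = c (O.tail (.inl i))) :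
    ∃ d : D.E → X, ∀ a, d (e a) = Sum.elim c c' a := by
  have key : ∀ a b, Relation.EqvGen (GlueRel O T) a b → Sum.elim c c' a = Sum.elim c c' b := by
    intro a b hab
    induction hab with
    | rel a b h =>
      cases h with
      | enter i => exact (ht i).symm
      | exit i => exact hh i
    | refl a => rfl
    | symm a b _ ih => exact ih.symm
    | trans a b c _ _ ih ih' => exact ih.trans ih'
  refine ⟨fun x => Sum.elim c c' (Function.surjInv hs x), fun a => key _ _ ?_⟩
  rw [← he]
  exact Function.surjInv_eq hs _

/-- The maps `v` on crossings and `e` on semi-arcs exhibit `D` as a gluing of `O` and `T`. -/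
structure IsGluingMap (O T : Tangle σ) (D : Diagram) (v : O.V ⊕ T.V ≃ D.V) (e : O.E ⊕ T.E → D.E) :
    Prop where
  surjective : Function.Surjective e
  eq_iff : ∀ a b, e a = e b ↔ Relation.EqvGen (GlueRel O T) a b
  kind_outer : ∀ c, D.kind (v (.inl c)) = O.kind c
  kind_inner : ∀ c, D.kind (v (.inr c)) = T.kind c
  inn_outer : ∀ c s, D.inn (v (.inl c)) s = e (.inl (O.inn c s))
  inn_inner : ∀ c s, D.inn (v (.inr c)) s = e (.inr (T.inn c s))
  out_outer : ∀ c s, D.out (v (.inl c)) s = e (.inl (O.out c s))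
  out_inner : ∀ c s, D.out (v (.inr c)) s = e (.inr (T.out c s))

theorem IsGluing.exists_isGluingMap {O T : Tangle σ} {D : Diagram} (h : IsGluing O T D) :
    ∃ v e, IsGluingMap O T D v e := by
  obtain ⟨v, e, h1, h2, h3, h4, h5, h6, h7, h8⟩ := h
  exact ⟨v, e, h1, h2, h3, h4, h5, h6, h7, h8⟩

theorem IsGluingMap.isState_iff {O T : Tangle σ} {D : Diagram} {v : O.V ⊕ T.V ≃ D.V}
    {e : O.E ⊕ T.E → D.E} (hg : IsGluingMap O T D v e) {K : Kind → CrossingRel X H}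
    {c : D.E → X} {g : D.V → H} :
    D.IsState K c g ↔ O.IsState K (fun a => c (e (.inl a))) (fun a => g (v (.inl a))) ∧
      T.IsState K (fun a => c (e (.inr a))) (fun a => g (v (.inr a))) := by
  simp only [Tangle.IsState, ← v.forall_congr_right, Sum.forall, hg.kind_outer, hg.kind_inner,
    hg.inn_outer, hg.inn_inner, hg.out_outer, hg.out_inner]

variable [CommGroup H] {S τ : X × X → X × X} {f h : X × X → H}

theorem Tangle.isState_of_coloring {T : Tangle σ} (c : T.Coloring S τ) :
    T.IsState (Kind.rel S τ f h) c.1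
      fun v => (T.kind v).weight f h (T.inColors c.1 v) (T.outColors c.1 v) :=
  fun v => ⟨c.2 v, rfl⟩

theorem Tangle.IsState.rule {T : Tangle σ} {c : T.E → X} {g : T.V → H}
    (hc : T.IsState (Kind.rel S τ f h) c g) (v : T.V) :
    (T.kind v).Rule S τ (T.inColors c v) (T.outColors c v) :=
  (hc v).1

theorem Tangle.IsState.weight_eq {T : Tangle σ} {c : T.E → X} {g : T.V → H}
    (hc : T.IsState (Kind.rel S τ f h) c g) : T.weight f h c = ∏ v, g v :=
  Finset.prod_congr rfl fun v _ => (hc v).2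

theorem IsGluingMap.exists_coloring {O T T' : Tangle σ} {D D' : Diagram} {v : O.V ⊕ T.V ≃ D.V}
    {e : O.E ⊕ T.E → D.E} {v' : O.V ⊕ T'.V ≃ D'.V} {e' : O.E ⊕ T'.E → D'.E}
    (hg : IsGluingMap O T D v e) (hg' : IsGluingMap O T' D' v' e')
    (hT : T'.Simulates (Kind.rel S τ f h) T) (c : D.Coloring S τ) :
    ∃ c' : D'.Coloring S τ, (∀ a, c.1 (e (.inl a)) = c'.1 (e' (.inl a))) ∧
      D'.weight f h c'.1 = D.weight f h c.1 := by
  have hc := Tangle.isState_of_coloring (f := f) (h := h) c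
  have hw := hc.weight_eq
  revert hc hw
  generalize (fun v => (D.kind v).weight f h (D.inColors c.1 v) (D.outColors c.1 v)) = g
  intro hc hw
  obtain ⟨hO, hT₀⟩ := hg.isState_iff.1 hc
  obtain ⟨d, k, hd, ht, hh, hp⟩ := hT _ _ hT₀
  obtain ⟨c', hc'⟩ := exists_glued_colors hg'.surjective hg'.eq_iff (fun a => c.1 (e (.inl a))) d
    (fun i => (ht i).trans (congrArg c.1 ((hg.eq_iff _ _).2 (.rel _ _ (.enter i))).symm))
    (fun i => (hh i).trans (congrArg c.1 ((hg.eq_iff _ _).2 (.rel _ _ (.exit i)))))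
  have hs : D'.IsState (Kind.rel S τ f h) c'
      fun w => Sum.elim (fun a => g (v (.inl a))) k (v'.symm w) := by
    rw [hg'.isState_iff]
    simpa [hc'] using ⟨hO, hd⟩
  refine ⟨⟨c', hs.rule⟩, fun a => (hc' (.inl a)).symm, ?_⟩
  rw [hs.weight_eq, hw, ← v'.prod_comp, ← v.prod_comp]
  simp [hp]

theorem IsGluingMap.coloring_ext {O T : Tangle σ} {D : Diagram} {v : O.V ⊕ T.V ≃ D.V}
    {e : O.E ⊕ T.E → D.E} (hg : IsGluingMap O T D v e)
    (hT : T.IsDetermined (Kind.rel S τ f h)) {c c' : D.Coloring S τ}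
    (hc : ∀ a, c.1 (e (.inl a)) = c'.1 (e (.inl a))) : c = c' := by
  have h1 := (hg.isState_iff.1 (Tangle.isState_of_coloring (f := f) (h := h) c)).2
  have h2 := (hg.isState_iff.1 (Tangle.isState_of_coloring (f := f) (h := h) c')).2
  have key := hT _ _ _ _ h1 h2
    (fun i => by
      simp only [← (hg.eq_iff _ _).2 (.rel _ _ (.enter i)), hc])
    (fun i => by
      simp only [(hg.eq_iff _ _).2 (.rel _ _ (.exit i)), hc])
  apply Subtype.ext
  funext x
  obtain ⟨a | a, rfl⟩ := hg.surjective x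
  exacts [hc a, congrFun key a]

/-- There is a bijection between the colorings of `D` and those of `D'` that preserves the
products of the Boltzmann weights. -/
def SameColorings (S τ : X × X → X × X) (f h : X × X → H) (D D' : Diagram) : Prop :=
  ∃ φ : D.Coloring S τ ≃ D'.Coloring S τ, ∀ c, D'.weight f h (φ c).1 = D.weight f h c.1

theorem sameColorings_of_localMove (hK : IsInvariantSystem (Kind.rel S τ f h)) {O T T' : Tangle σ}
    {D D' : Diagram} (m : LocalMove T T') (g : IsGluing O T D) (g' : IsGluing O T' D') :
    SameColorings S τ f h D D' := by
  obtain ⟨v, e, hg⟩ := g.exists_isGluingMap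
  obtain ⟨v', e', hg'⟩ := g'.exists_isGluingMap
  obtain ⟨hT', hT⟩ := m.simulates hK
  obtain ⟨dT, dT'⟩ := m.isDetermined hK
  obtain ⟨φ, hφ⟩ := exists_equiv_of_existsUnique
    (r := fun (c : D.Coloring S τ) (c' : D'.Coloring S τ) =>
      ∀ a, c.1 (e (.inl a)) = c'.1 (e' (.inl a)))
    (fun c => by
      obtain ⟨c', hc', -⟩ := hg.exists_coloring hg' hT' c
      exact ⟨c', hc', fun d hd => hg'.coloring_ext dT' fun a => (hd a).symm.trans (hc' a)⟩)
    (fun c => by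
      obtain ⟨c', hc', -⟩ := hg'.exists_coloring hg hT c
      exact ⟨c', fun a => (hc' a).symm,
        fun d hd => hg.coloring_ext dT fun a => (hd a).trans (hc' a)⟩)
  refine ⟨φ, fun c => ?_⟩
  obtain ⟨c', hc', hw⟩ := hg.exists_coloring hg' hT' c
  rwa [hg'.coloring_ext dT' fun a => (hφ c a).symm.trans (hc' a)]

theorem sameColorings_of_iso {D D' : Diagram} (i : Diagram.Iso D D') :
    SameColorings S τ f h D D' := by
  obtain ⟨v, e, hk, hi, ho⟩ := i
  refine ⟨Equiv.subtypeEquiv (e.arrowCongr (Equiv.refl X)) fun c => ?_, fun c => ?_⟩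
  · rw [← v.forall_congr_right]
    simp [Tangle.inColors, Tangle.outColors, hk, hi, ho]
  · rw [Tangle.weight, Tangle.weight, ← v.prod_comp]
    have key : ∀ a, (e.arrowCongr (Equiv.refl X) c.1) (e a) = c.1 a := by simp
    simp only [Tangle.inColors, Tangle.outColors, hk, hi, ho]
    exact Finset.prod_congr rfl fun w _ => by
      rw [← key, ← key (D.inn w .right), ← key (D.out w .left), ← key (D.out w .right)]
      rfl

theorem sameColorings_of_sameLink (hK : IsInvariantSystem (Kind.rel S τ f h)) {D D' : PlanarDiagram}
    (hD : SameLink D D') : SameColorings S τ f h D.1 D'.1 := by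
  induction hD with
  | rel D D' hs =>
    cases hs with
    | iso i => exact sameColorings_of_iso i
    | move O T T' m g g' => exact sameColorings_of_localMove hK m g g'
  | refl D => exact ⟨Equiv.refl _, fun _ => rfl⟩
  | symm D D' _ ih =>
    obtain ⟨φ, hφ⟩ := ih
    exact ⟨φ.symm, fun c => by simpa using (hφ (φ.symm c)).symm⟩
  | trans D D' D'' _ _ ih ih' =>
    obtain ⟨φ, hφ⟩ := ih
    obtain ⟨ψ, hψ⟩ := ih'
    exact ⟨φ.trans ψ, fun c => (hψ _).trans (hφ c)⟩

end Gluing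

end SingularLinks

theorem mainTheorem4 {X H : Type*} [CommGroup H] (S τ : X × X → X × X)
    (hSτ : SingularLinks.IsSingularPair S τ) (f h : X × X → H)
    (hfh : SingularLinks.IsAbelianCocyclePair S τ f h)
    (D D' : SingularLinks.PlanarDiagram) (hDD' : SingularLinks.SameLink D D')
    (hfin : Finite (D.1.Coloring S τ)) :
    Finite (D'.1.Coloring S τ) ∧ D.1.stateSum S τ f h = D'.1.stateSum S τ f h := by
  obtain ⟨φ, hφ⟩ := SingularLinks.sameColorings_of_sameLink
    (SingularLinks.isInvariantSystem_rel hSτ hfh) hDD'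
  refine ⟨Finite.of_equiv _ φ, ?_⟩
  rw [SingularLinks.Tangle.stateSum, SingularLinks.Tangle.stateSum, ← finsum_comp_equiv φ]
  simp only [hφ]
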